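/- Let $\mathbb F_q$ be a finite field with $q$ elements and let $k\le n$ and $\beta$ be non-negative integers such that $\beta$ divides $n-k$. For a matrix $\mathbf B=(\mathbf b_1;\dots;\mathbf b_k)\in\mathbb F_q^{k\times n}$ with rows $\mathbf b_i$, the $i$th epipodal vector $\mathbf b_i^+\in\mathbb F_q^n$ is obtained from $\mathbf b_i$ by setting to zero every coordinate in which at least one of $\mathbf b_1,\dots,\mathbf b_{i-1}$ is nonzero; $|\cdot|$ denotes the Hamming weight. *Max Redundant Set.* On input a matrix, scale each nonzero column so that its first nonzero entry is $1$, and return a set of nonzero columns of maximal size whose scaled columns all coincide (ties are broken by an arbitrary rule depending only on the input matrix). *Backward Reduction.* On input a matrix $\mathbf B$, let $\{j_1<\dots<j_t\}$ be the output of Max Redundant Set on $\mathbf B$, and let $m$ be minimal with $B_{m,j_1}\ne0$. For every $i>m$ replace $\mathbf b_i$ by $\mathbf b_i-B_{m,j_1}^{-1}B_{i,j_1}\mathbf b_m$; then move row $m$ to the last position, keeping the order of the other rows. Return the invertible matrix $\mathbf A$ that represents these row operations. *Selective Backward Reduction.* On input $\mathbf B\in\mathbb F_q^{k\times n}$ and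 $\beta$: 1. Let $S$ be the set of indices of the first $k$ linearly independent columns of $\mathbf B$. Fail if no such set exists or if $S\not\subseteq\{1,\dots,k+\beta\}$. 2. Replace $\mathbf B$ by $(\mathbf B|_S)^{-1}\mathbf B$, where $\mathbf B|_S$ is the submatrix of the columns in $S$. Set $j\leftarrow k+2\beta$. 3. For $i=(n-k)/\beta-1,\dots,1$: let $\mathbf A$ be the output of Backward Reduction on the submatrix of the first $i$ rows and first $j$ columns of $\mathbf B$ (all $k$ rows if $i>k$); apply to $\mathbf B$ the row operations $\mathbf A$ on these rows, i.e. $\mathbf B\leftarrow(\mathbf A\oplus\mathbf I)\mathbf B$; set $j\leftarrow j+\beta$. 4. Return $\mathbf B$. **Theorem.** Suppose that $$7\le\beta\le\frac{n-k}{2\log_q(n-k)+1},$$ and let $\varepsilon\in(0,1)$. If Selective Backward Reduction is run on a uniformly random matrix in $\mathbb F_q^{k\times n}$ and $\beta$, then with probability at least $$1-\log_q(\beta)\,2^{1-\beta/20}-\varepsilon$$ it does not fail and its output $(\mathbf b_1;\dots;\mathbf b_k)$ satisfies $|\mathbf b_i^+|\ge2$ for all $1\le i\le k$ with $$i\le 2\log_q\beta-\log_q\bigl(20\log_2(2/\varepsilon)\bigr).$$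 -/

import Mathlib

namespace CodeReduction

variable {F : Type*} [Field F] [DecidableEq F]

/-- The `i`th epipodal vector of `B`: the `i`th row, with the coordinates lying in the support of
an earlier row replaced by `0`. -/
def epipodal {k n : ℕ} (B : Matrix (Fin k) (Fin n) F) (i : Fin k) : Fin n → F :=
  fun c => if ∀ i' : Fin k, i' < i → B i' c = 0 then B i c else 0

/-- The code generated by the rows of `B`. -/
def code {k n : ℕ} (B : Matrix (Fin k) (Fin n) F) : Submodule F (Fin n → F) :=
  Submodule.span F (Set.range B.row)

/-- The support of a code: the coordinates in which some codeword is nonzero. -/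
def codeSupport {n : ℕ} (C : Submodule F (Fin n → F)) : Set (Fin n) :=
  {j | ∃ c ∈ C, c j ≠ 0}

/-- The first row in which column `j` of `B` is nonzero. -/
def leadRow {k n : ℕ} (B : Matrix (Fin k) (Fin n) F) (j : Fin n) (h : ∃ i, B i j ≠ 0) : Fin k :=
  (Finset.univ.filter fun i => B i j ≠ 0).min' (by
    obtain ⟨i, hi⟩ := h
    exact ⟨i, by simpa using hi⟩)

/-- The inverse of the first nonzero entry of column `j` (the value on a zero column is never
used). -/
def colScale {k n : ℕ} (B : Matrix (Fin k) (Fin n) F) (j : Fin n) : F :=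
  if h : ∃ i, B i j ≠ 0 then (B (leadRow B j h) j)⁻¹ else 0

/-- `S` lies in the support of the code generated by `B`, and the columns of `B` indexed by `S`
become equal once each is scaled so that its first nonzero entry is `1`. -/
def HasEqualScaledCols {k n : ℕ} (B : Matrix (Fin k) (Fin n) F) (S : Finset (Fin n)) : Prop :=
  (∀ j ∈ S, j ∈ codeSupport (code B)) ∧
    ∀ j₁ ∈ S, ∀ j₂ ∈ S, ∀ i, colScale B j₁ * B i j₁ = colScale B j₂ * B i j₂

/-- `S` is a possible output of the subroutine Max Redundant Set on input `B`: a set as in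
`HasEqualScaledCols` of maximal size. There may be several such sets. -/
def IsMaxRedundantSet {k n : ℕ} (B : Matrix (Fin k) (Fin n) F) (S : Finset (Fin n)) : Prop :=
  HasEqualScaledCols B S ∧ ∀ T : Finset (Fin n), HasEqualScaledCols B T → T.card ≤ S.card

/-- `sel` implements the subroutine Max Redundant Set: on every input matrix it returns one of
the sets of maximal size, with ties broken in an arbitrary way that depends on the input only. -/
def IsMaxRedundantSetRule (sel : ∀ k n : ℕ, Matrix (Fin k) (Fin n) F → Finset (Fin n)) : Prop :=
  ∀ (k n : ℕ) (B : Matrix (Fin k) (Fin n) F), IsMaxRedundantSet B (sel k n B)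

theorem exists_isMaxRedundantSet {k n : ℕ} (B : Matrix (Fin k) (Fin n) F) :
    ∃ S, IsMaxRedundantSet B S := by
  classical
  obtain ⟨S, hS, hmax⟩ := Finset.exists_max_image
    (Finset.univ.filter fun S : Finset (Fin n) => HasEqualScaledCols B S) Finset.card
    ⟨∅, Finset.mem_filter.2 ⟨Finset.mem_univ _, by simp [HasEqualScaledCols]⟩⟩
  exact ⟨S, (Finset.mem_filter.1 hS).2,
    fun T hT => hmax T (Finset.mem_filter.2 ⟨Finset.mem_univ _, hT⟩)⟩

theorem exists_isMaxRedundantSetRule :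
    ∃ sel : ∀ k n : ℕ, Matrix (Fin k) (Fin n) F → Finset (Fin n), IsMaxRedundantSetRule sel :=
  ⟨fun _ _ B => (exists_isMaxRedundantSet B).choose,
    fun _ _ B => (exists_isMaxRedundantSet B).choose_spec⟩

/-- Subtract `c i` times row `m` from row `i`, for every row `i` below row `m`. -/
def eliminateBelow {k : ℕ} {ι : Type*} (m : Fin k) (c : Fin k → F) (M : Matrix (Fin k) ι F) :
    Matrix (Fin k) ι F :=
  fun i => if m < i then M i - c i • M m else M i

/-- Move row `m` to the last position, keeping the order of the other rows. -/
def moveRowToEnd {k : ℕ} {ι : Type*} (m : Fin k) (M : Matrix (Fin k) ι F) :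
    Matrix (Fin k) ι F :=
  fun i => if i < m then M i else if h : (i : ℕ) + 1 < k then M ⟨i + 1, h⟩ else M m

/-- Backward Reduction, run with the implementation `sel` of Max Redundant Set. The output is the
matrix of the row operations performed, i.e. the result of applying them to the identity.
(A matrix without nonzero column is not a legal input; the identity is returned there.) -/
def backwardReduction (sel : ∀ k n : ℕ, Matrix (Fin k) (Fin n) F → Finset (Fin n))
    {k n : ℕ} (B : Matrix (Fin k) (Fin n) F) : Matrix (Fin k) (Fin k) F :=
  if hS : (sel k n B).Nonempty then
    let j₁ := (sel k n B).min' hS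
    if h : ∃ i, B i j₁ ≠ 0 then
      let m := leadRow B j₁ h
      moveRowToEnd m (eliminateBelow m (fun i => (B m j₁)⁻¹ * B i j₁) 1)
    else 1
  else 1

/-- The first `i` rows and first `j` columns of `B` (all rows if `i` exceeds their number, and
likewise for columns). -/
def corner {k n : ℕ} (i j : ℕ) (B : Matrix (Fin k) (Fin n) F) :
    Matrix (Fin (min i k)) (Fin (min j n)) F :=
  B.submatrix (Fin.castLE (min_le_right i k)) (Fin.castLE (min_le_right j n))

/-- The direct sum of `A` and an identity matrix, of total size `k`. -/
def extendByOne {k i : ℕ} (hi : i ≤ k) (A : Matrix (Fin i) (Fin i) F) :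
    Matrix (Fin k) (Fin k) F :=
  let e : Fin i ⊕ Fin (k - i) ≃ Fin k := finSumFinEquiv.trans (finCongr (Nat.add_sub_cancel' hi))
  Matrix.reindex e e (Matrix.fromBlocks A 0 0 1)

/-- One iteration of the loop: backward reduce the upper left `i × j` corner of `B`, applying the
row operations to the whole of the first `i` rows. -/
def reduceCorner (sel : ∀ k n : ℕ, Matrix (Fin k) (Fin n) F → Finset (Fin n))
    {k n : ℕ} (i j : ℕ) (B : Matrix (Fin k) (Fin n) F) : Matrix (Fin k) (Fin n) F :=
  extendByOne (min_le_right i k) (backwardReduction sel (corner i j B)) * B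

/-- The loop over `i, i - 1, …, 1`, where `j` grows by `β` after every iteration. -/
def reduceLoop (sel : ∀ k n : ℕ, Matrix (Fin k) (Fin n) F → Finset (Fin n))
    {k n : ℕ} (β : ℕ) : (i j : ℕ) → Matrix (Fin k) (Fin n) F → Matrix (Fin k) (Fin n) F
  | 0, _, B => B
  | i + 1, j, B => reduceLoop sel β i (j + β) (reduceCorner sel (i + 1) j B)

open Classical in
/-- The columns that are not linear combinations of earlier columns. If `B` has rank `k`, these
are the first `k` linearly independent columns. -/
noncomputable def pivotCols {k n : ℕ} (B : Matrix (Fin k) (Fin n) F) : Finset (Fin n) :=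
  Finset.univ.filter fun j => B.col j ∉ Submodule.span F (B.col '' {j' | j' < j})

/-- Multiply `B` by the inverse of its square submatrix on the columns `S`. -/
noncomputable def systematize {k n : ℕ} (B : Matrix (Fin k) (Fin n) F) (S : Finset (Fin n))
    (hS : S.card = k) : Matrix (Fin k) (Fin n) F :=
  (B.submatrix id (S.orderEmbOfFin hS))⁻¹ * B

open Classical in
/-- Selective Backward Reduction; the output `none` means that the algorithm fails. -/
noncomputable def selectiveBackwardReduction
    (sel : ∀ k n : ℕ, Matrix (Fin k) (Fin n) F → Finset (Fin n))
    {k n : ℕ} (β : ℕ) (B : Matrix (Fin k) (Fin n) F) : Option (Matrix (Fin k) (Fin n) F) :=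
  if h : (pivotCols B).card = k ∧ ∀ j ∈ pivotCols B, (j : ℕ) < k + β then
    some (reduceLoop sel β ((n - k) / β - 1) (k + 2 * β) (systematize B (pivotCols B) h.1))
  else none

end CodeReduction

namespace CodeReduction

/-! The algorithm succeeds as soon as the first `k + β` columns span the column space. Otherwise
some nonzero vector annihilates those columns from the left, and a union bound over such vectors
gives probability at most `q ^ (-β)` (`density_not_leadingColsSpan_le`).

Row `r` (counted from `0`) gets its final value in the iteration on the upper `r + 1` rows. Backward
Reduction clears the chosen redundant columns above row `r`, and later iterations only combine rows
above `r`. Hence the epipodal vector is nonzero on every chosen column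
(`card_sel_le_hammingNorm_epipodal`), and it suffices that the corner contain two equal nonzero
columns.

Every iteration brings in `β` columns that no earlier step has inspected. All previous row
operations are determined by the older columns, so they multiply the fresh block by an invertible
matrix independent of that block, and the block stays uniform. This conditioning argument takes the
form of an injective self-map of the space of matrices (`replaceBlock_injective`). A birthday bound
(`density_injectiveOffZero_le`) then controls the probability that `β` uniform vectors of length `r
+ 1` have no nonzero collision. Summing over the rows gives the stated failure probability
(`failure_sum_le`). -/

/-- The proportion of elements of a finite type that lie in `s`. -/
noncomputable def density {α : Type*} (s : Set α) : ℝ := s.ncard / Nat.card α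

/-! ### Uniform probability as a proportion of elements. -/

section density

variable {α : Type*} [Finite α]

theorem density_mono {s t : Set α} (h : s ⊆ t) : density s ≤ density t := by
  unfold density
  have := Set.ncard_le_ncard h t.toFinite
  gcongr

theorem density_union_le {α : Type*} (s t : Set α) : density (s ∪ t) ≤ density s + density t := by
  unfold density
  rw [← add_div]
  have := Set.ncard_union_le s t
  gcongr
  exact_mod_cast this

theorem density_biUnion_le {α ι : Type*} (I : Finset ι) (s : ι → Set α) :
    density (⋃ i ∈ I, s i) ≤ ∑ i ∈ I, density (s i) := by
  classical
  induction I using Finset.induction_on with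
  | empty => simp [density]
  | insert a I ha ih =>
    rw [Finset.set_biUnion_insert, Finset.sum_insert ha]
    exact (density_union_le _ _).trans (by gcongr)

theorem density_add_density_compl [Nonempty α] (s : Set α) : density s + density sᶜ = 1 := by
  unfold density
  rw [← add_div, ← Nat.cast_add, Set.ncard_add_ncard_compl]
  have : Nat.card α ≠ 0 := Nat.card_pos.ne'
  field_simp

/-- Takes the place of conditional probability: a random matrix whose fresh columns are transformed
by an injective rule is no likelier to lie in `s` than a uniform one. -/
theorem density_preimage_le_of_injective {f : α → α} (hf : f.Injective) (s : Set α) :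
    density (f ⁻¹' s) ≤ density s := by
  unfold density
  have : (f ⁻¹' s).ncard ≤ s.ncard :=
    Set.ncard_le_ncard_of_injOn f (fun _ h => h) hf.injOn s.toFinite
  gcongr

/-- A surjective homomorphism of finite groups maps the uniform distribution to the uniform
distribution. -/
theorem density_preimage_of_surjective {A C : Type*} [AddGroup A] [Finite A] [AddGroup C]
    [Finite C] (f : A →+ C) (hf : Function.Surjective f) (E : Set C) :
    density (f ⁻¹' E) = density E := by
  classical
  have := Fintype.ofFinite A
  have := Fintype.ofFinite C
  have key : ∀ E : Finset C,
      (Finset.univ.filter fun a => f a ∈ E).card =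
        E.card * (Finset.univ.filter fun a => f a = 0).card := by
    intro E
    rw [Finset.card_eq_sum_card_fiberwise (f := f) (t := E) (by intro x; simp)]
    rw [Finset.sum_const_nat]
    intro c hc
    rw [Finset.filter_filter]
    rw [← AddMonoidHom.card_fiber_eq_of_mem_range f (hf c) (hf 0)]
    congr 1
    ext a
    simp only [Finset.mem_filter, Finset.mem_univ, true_and]
    exact ⟨fun h => h.2, fun h => ⟨h ▸ hc, h⟩⟩
  have h1 := key E.toFinset
  have h2 := key Finset.univ
  simp only [Finset.mem_univ, Finset.filter_true, Finset.card_univ] at h2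
  have h0 : (Finset.univ.filter fun a => f a = 0).card ≠ 0 :=
    (Finset.card_pos.2 ⟨0, by simp⟩).ne'
  unfold density
  rw [Nat.card_eq_fintype_card, Nat.card_eq_fintype_card, h2, Set.ncard_eq_toFinset_card',
    Set.ncard_eq_toFinset_card', ← h1.symm.trans (congrArg Finset.card _)]
  · push_cast
    rw [mul_div_mul_right]
    exact_mod_cast h0
  · ext; simp

theorem toReal_uniformOfFintype_apply {α : Type*} [Fintype α] [Nonempty α] (s : Set α) :
    ((PMF.uniformOfFintype α).toOuterMeasure s).toReal = density s := by
  classical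
  rw [PMF.toOuterMeasure_uniformOfFintype_apply, density, ENNReal.toReal_div,
    ENNReal.toReal_natCast, ENNReal.toReal_natCast, Nat.card_eq_fintype_card,
    ← Nat.card_coe_set_eq, Nat.card_eq_fintype_card]

end density

/-! ### A birthday bound that ignores collisions at zero. -/

section birthday

/-- The nonzero values of `v` are pairwise distinct. -/
def InjectiveOffZero {ι V : Type*} [Zero V] (v : ι → V) : Prop :=
  ∀ a b, v a = v b → v a ≠ 0 → a = b

/-- Sort the families by their support `T`: on `T` such a family is an embedding into the nonzero
elements, and off `T` it vanishes. -/
theorem ncard_injectiveOffZero_le {ι V : Type*} [Fintype ι] [Zero V] [Fintype V] :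
    {v : ι → V | InjectiveOffZero v}.ncard ≤
      ∑ T : Finset ι, (Fintype.card V - 1).descFactorial T.card := by
  classical
  have hsub : {v : ι → V | InjectiveOffZero v} ⊆
      ⋃ T ∈ (Finset.univ : Finset (Finset ι)), {v | InjectiveOffZero v ∧ ∀ a, a ∈ T ↔ v a ≠ 0} := by
    intro v hv
    simp only [Set.mem_iUnion]
    exact ⟨Finset.univ.filter fun a => v a ≠ 0, Finset.mem_univ _, hv, by simp⟩
  refine (Set.ncard_le_ncard hsub (Set.toFinite _)).trans ?_
  refine (Finset.set_ncard_biUnion_le _ _).trans (Finset.sum_le_sum fun T _ => ?_)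
  have hcard : Nat.card (T ↪ {x : V // x ≠ 0}) = (Fintype.card V - 1).descFactorial T.card := by
    rw [Nat.card_eq_fintype_card, Fintype.card_embedding_eq, Fintype.card_coe,
      Fintype.card_subtype_compl, Fintype.card_subtype_eq]
  rw [← hcard, ← Nat.card_coe_set_eq]
  let g : {v : ι → V | InjectiveOffZero v ∧ ∀ a, a ∈ T ↔ v a ≠ 0} → (T ↪ {x : V // x ≠ 0}) :=
    fun v => ⟨fun a => ⟨v.1 a, (v.2.2 a).1 a.2⟩, fun a b h =>
      Subtype.ext (v.2.1 a b (congrArg Subtype.val h) ((v.2.2 a).1 a.2))⟩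
  refine Nat.card_le_card_of_injective g fun v w h => Subtype.ext (funext fun a => ?_)
  by_cases ha : a ∈ T
  · exact congrArg Subtype.val (DFunLike.congr_fun h ⟨a, ha⟩)
  · rw [not_not.1 fun h => ha ((v.2.2 a).2 h), not_not.1 fun h => ha ((w.2.2 a).2 h)]

/-- Each factor satisfies `m - r ≤ m (1 - r / (m + 1)) ≤ m exp (-r / (m + 1))`. The weaker
denominator `m + 1` is the cardinality of the whole space `V`, of which `m` counts the nonzero
elements. -/
theorem descFactorial_le_pow_mul_exp (m r : ℕ) :
    (m.descFactorial r : ℝ) ≤ m ^ r * Real.exp (-((r : ℝ) * (r - 1)) / (2 * (m + 1))) := by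
  induction r with
  | zero => simp
  | succ r ih =>
    rw [Nat.descFactorial_succ, Nat.cast_mul]
    rcases Nat.eq_zero_or_pos m with rfl | hm
    · simp
    have hm' : (0 : ℝ) < m := by exact_mod_cast hm
    have hstep : ((m - r : ℕ) : ℝ) ≤ m * Real.exp (-(r : ℝ) / (m + 1)) := by
      rcases le_total m r with h | h
      · rw [Nat.sub_eq_zero_of_le h, Nat.cast_zero]; positivity
      · rw [Nat.cast_sub h]
        have h1 := Real.add_one_le_exp (-(r : ℝ) / (m + 1))
        have h2 : (m : ℝ) - r ≤ m * (-(r : ℝ) / (m + 1) + 1) := by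
          have : (m : ℝ) * (-(r : ℝ) / (m + 1) + 1) - (m - r) = r / (m + 1) := by
            field_simp; ring
          have : (0 : ℝ) ≤ r / (m + 1) := by positivity
          linarith
        exact h2.trans (by gcongr)
    calc ((m - r : ℕ) : ℝ) * (m.descFactorial r : ℝ)
        ≤ (m * Real.exp (-(r : ℝ) / (m + 1))) *
          (m ^ r * Real.exp (-((r : ℝ) * (r - 1)) / (2 * (m + 1)))) := by gcongr
      _ = m ^ (r + 1) * (Real.exp (-(r : ℝ) / (m + 1)) *
          Real.exp (-((r : ℝ) * (r - 1)) / (2 * (m + 1)))) := by ring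
      _ = _ := by
        rw [← Real.exp_add]
        congr 2
        push_cast
        field_simp
        ring

/-- The Chernoff estimate for supports smaller than `9/25` of the index set. After taking `b`-th
roots it reduces to `2 ^ (41/100) ≤ 4/3`. -/
theorem three_quarters_pow_mul_le (b : ℕ) :
    (3 / 4 : ℝ) ^ b * 2 ^ ((9 / 25 : ℝ) * b) ≤ 2 ^ (-(b : ℝ) / 20) := by
  have h1 : (3 / 4 : ℝ) * 2 ^ (9 / 25 : ℝ) ≤ 2 ^ (-(1 : ℝ) / 20) := by
    have h2 : (2 : ℝ) ^ (41 / 100 : ℝ) ≤ 4 / 3 := by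
      refine le_of_pow_le_pow_left₀ (n := 100) (by norm_num) (by norm_num) ?_
      rw [← Real.rpow_natCast, ← Real.rpow_mul (by norm_num)]
      norm_num
    have h3 : (2 : ℝ) ^ (9 / 25 : ℝ) = 2 ^ (41 / 100 : ℝ) * 2 ^ (-(1 : ℝ) / 20) := by
      rw [← Real.rpow_add (by norm_num)]; norm_num
    have h4 : (0 : ℝ) < 2 ^ (-(1 : ℝ) / 20) := by positivity
    rw [h3]
    nlinarith
  have h5 := pow_le_pow_left₀ (by positivity) h1 b
  rw [mul_pow, ← Real.rpow_mul_natCast (by norm_num), ← Real.rpow_mul_natCast (by norm_num)] at h5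
  refine h5.trans_eq ?_
  congr 1
  ring

/-- The collision estimate for large supports. For `b ≥ 7`, `r (r - 1) ≥ 0.36 b (0.36 b - 1) ≥
0.0694 b ^ 2`, and `0.694` exceeds `log 2`. -/
theorem exp_le_two_rpow_of_le {b r Q : ℝ} (hb : 7 ≤ b) (hr : 9 / 25 * b ≤ r) (hQ : 0 < Q) :
    Real.exp (-(r * (r - 1)) / (2 * Q)) ≤ 2 ^ (-(b ^ 2) / (20 * Q)) := by
  rw [Real.rpow_def_of_pos (by norm_num), Real.exp_le_exp]
  have h2 : Real.log 2 ≤ 0.694 := by linarith [Real.log_two_lt_d9]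
  have h3 : (0.0694 : ℝ) * b ^ 2 ≤ r * (r - 1) := by nlinarith
  have h4 : Real.log 2 * b ^ 2 ≤ 10 * (r * (r - 1)) := by nlinarith [sq_nonneg b]
  have : Real.log 2 * (-b ^ 2 / (20 * Q)) - (-(r * (r - 1)) / (2 * Q)) =
      (10 * (r * (r - 1)) - Real.log 2 * b ^ 2) / (20 * Q) := by
    field_simp; ring
  have : 0 ≤ (10 * (r * (r - 1)) - Real.log 2 * b ^ 2) / (20 * Q) :=
    div_nonneg (by linarith) (by positivity)
  linarith

/-- Few random vectors suffice for two equal nonzero ones. -/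
theorem density_injectiveOffZero_le {ι V : Type*} [Fintype ι] [Zero V] [Fintype V] [Nontrivial V]
    (hb : 7 ≤ Fintype.card ι) :
    density {v : ι → V | InjectiveOffZero v} ≤
      2 ^ (-(Fintype.card ι : ℝ) / 20) +
        2 ^ (-((Fintype.card ι : ℝ) ^ 2) / (20 * Fintype.card V)) := by
  classical
  obtain ⟨m, hm⟩ : ∃ m, Fintype.card V = m + 1 :=
    ⟨Fintype.card V - 1, by have := Fintype.card_pos (α := V); omega⟩
  have hm1 : 1 ≤ m := by have := Fintype.one_lt_card (α := V); omega
  set b := Fintype.card ι with hbdef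
  have hle := ncard_injectiveOffZero_le (ι := ι) (V := V)
  rw [hm, Nat.add_sub_cancel] at hle
  set P : ℝ := 2 ^ (-((b : ℝ) ^ 2) / (20 * (m + 1 : ℕ))) with hP
  -- The first summand bounds small supports, through `2 ^ |T| ≤ 2 ^ (9b/25)`; the second bounds
  -- large ones. The factors `1 ^ (b - |T|)` prepare the binomial theorem over subsets.
  have hterm : ∀ T : Finset ι, (m.descFactorial T.card : ℝ) ≤
      2 ^ ((9 / 25 : ℝ) * b) * ((m / 2 : ℝ) ^ T.card * 1 ^ (b - T.card)) +
        P * ((m : ℝ) ^ T.card * 1 ^ (b - T.card)) := by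
    intro T
    simp only [one_pow, mul_one]
    set r := T.card
    rcases le_total ((9 / 25 : ℝ) * b) r with h | h
    · have h1 := descFactorial_le_pow_mul_exp m r
      have h2 := exp_le_two_rpow_of_le (Q := (m + 1 : ℕ)) (by exact_mod_cast hb) h (by positivity)
      push_cast at h2
      have h3 : (m : ℝ) ^ r * Real.exp (-((r : ℝ) * (r - 1)) / (2 * (m + 1))) ≤ m ^ r * P := by
        rw [hP]; push_cast; gcongr
      have h4 : (0 : ℝ) ≤ 2 ^ ((9 / 25 : ℝ) * b) * (m / 2 : ℝ) ^ r := by positivity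
      linarith
    · have h1 : (m.descFactorial r : ℝ) ≤ m ^ r := by
        exact_mod_cast Nat.descFactorial_le_pow m r
      have h2 : (2 : ℝ) ^ r ≤ 2 ^ ((9 / 25 : ℝ) * b) := by
        rw [← Real.rpow_natCast]
        exact Real.rpow_le_rpow_of_exponent_le (by norm_num) h
      have h3 : (m : ℝ) ^ r = 2 ^ r * (m / 2 : ℝ) ^ r := by
        rw [← mul_pow]; congr 1; ring
      have h4 : (2 : ℝ) ^ r * (m / 2 : ℝ) ^ r ≤ 2 ^ ((9 / 25 : ℝ) * b) * (m / 2 : ℝ) ^ r := by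
        gcongr
      have h5 : 0 ≤ P * (m : ℝ) ^ r := by positivity
      linarith
  have hsum : ((∑ T : Finset ι, m.descFactorial T.card : ℕ) : ℝ) ≤
      2 ^ ((9 / 25 : ℝ) * b) * (m / 2 + 1 : ℝ) ^ b + P * (m + 1 : ℝ) ^ b := by
    push_cast
    refine (Finset.sum_le_sum fun T _ => hterm T).trans_eq ?_
    rw [Finset.sum_add_distrib, ← Finset.mul_sum, ← Finset.mul_sum, Fintype.sum_pow_mul_eq_add_pow,
      Fintype.sum_pow_mul_eq_add_pow]
  have hcardV : (Nat.card (ι → V) : ℝ) = (m + 1 : ℝ) ^ b := by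
    rw [Nat.card_eq_fintype_card, Fintype.card_fun, hm]; push_cast; rfl
  have hpos : (0 : ℝ) < (m + 1 : ℝ) ^ b := by positivity
  unfold density
  rw [hcardV, hm, div_le_iff₀ hpos, add_mul]
  refine ((Nat.cast_le (α := ℝ)).2 hle).trans (hsum.trans ?_)
  gcongr ?_ + ?_
  -- The ratio `(m/2 + 1) / (m + 1)` is largest at `m = 1`, where it equals `3/4`.
  · have h1 : (m / 2 + 1 : ℝ) ^ b ≤ (3 / 4 * (m + 1)) ^ b := by
      have : (1 : ℝ) ≤ m := by exact_mod_cast hm1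
      gcongr
      linarith
    calc (2 : ℝ) ^ ((9 / 25 : ℝ) * b) * (m / 2 + 1 : ℝ) ^ b
        ≤ 2 ^ ((9 / 25 : ℝ) * b) * (3 / 4 * (m + 1)) ^ b := by gcongr
      _ = ((3 / 4) ^ b * 2 ^ ((9 / 25 : ℝ) * b)) * (m + 1 : ℝ) ^ b := by rw [mul_pow]; ring
      _ ≤ _ := by gcongr; exact three_quarters_pow_mul_le b
  · exact le_rfl

end birthday

variable {F : Type*} [Field F]

/-! ### Row operations as invertible left multiplications. -/

section rowOperations

theorem moveRowToEnd_eliminateBelow_one_mul {k : ℕ} {ι : Type*} (m : Fin k) (c : Fin k → F)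
    (M : Matrix (Fin k) ι F) :
    moveRowToEnd m (eliminateBelow m c (1 : Matrix (Fin k) (Fin k) F)) * M =
      moveRowToEnd m (eliminateBelow m c M) := by
  have hrow : ∀ i j, ∑ x, eliminateBelow m c (1 : Matrix (Fin k) (Fin k) F) i x * M x j =
      eliminateBelow m c M i j := by
    intro i j
    unfold eliminateBelow
    split_ifs with h
    · simp [sub_mul, Finset.sum_sub_distrib, Matrix.one_apply]
    · simp [Matrix.one_apply]
  ext i j
  rw [Matrix.mul_apply]
  unfold moveRowToEnd
  split_ifs <;> exact hrow _ j

theorem eliminateBelow_injective {k : ℕ} {ι : Type*} (m : Fin k) (c : Fin k → F) :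
    Function.Injective (eliminateBelow m c : Matrix (Fin k) ι F → Matrix (Fin k) ι F) := by
  intro M N h
  have hm : M m = N m := by simpa [eliminateBelow] using congrFun h m
  ext i j
  have hi := congrFun (congrFun h i) j
  by_cases hmi : m < i
  · simpa [eliminateBelow, hmi, hm] using hi
  · simpa [eliminateBelow, hmi] using hi

theorem exists_moveRowToEnd_eq {F : Type*} {k : ℕ} (m i : Fin k) :
    ∃ x : Fin k, ∀ {ι : Type*} (M : Matrix (Fin k) ι F), moveRowToEnd m M x = M i := by
  rcases lt_trichotomy i m with h | rfl | h
  · exact ⟨i, fun M => by simp [moveRowToEnd, h]⟩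
  · refine ⟨⟨k - 1, by have := i.2; omega⟩, fun M => ?_⟩
    have h1 : ¬ ((⟨k - 1, by have := i.2; omega⟩ : Fin k) < i) := by
      rw [Fin.lt_def]; have := i.2; simp only; omega
    have h2 : ¬ (k - 1 + 1 < k) := by omega
    simp [moveRowToEnd, h1, h2]
  · rw [Fin.lt_def] at h
    have h1 : ¬ ((⟨i - 1, by omega⟩ : Fin k) < m) := by
      rw [Fin.lt_def]; simp only; omega
    have h2 : (i : ℕ) - 1 + 1 = i := by omega
    exact ⟨⟨i - 1, by omega⟩, fun M => by simp [moveRowToEnd, h1, h2]⟩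

theorem moveRowToEnd_injective {F : Type*} {k : ℕ} {ι : Type*} (m : Fin k) :
    Function.Injective (moveRowToEnd m : Matrix (Fin k) ι F → Matrix (Fin k) ι F) := by
  intro M N h
  funext i
  obtain ⟨x, hx⟩ := exists_moveRowToEnd_eq (F := F) m i
  rw [← hx M, ← hx N, h]

theorem moveRowToEnd_apply_of_lt {F : Type*} {k : ℕ} {ι : Type*} (m : Fin k) (M : Matrix (Fin k) ι F)
    (x : Fin k) (hx : (x : ℕ) + 1 < k) : ∃ i, i ≠ m ∧ moveRowToEnd m M x = M i := by
  by_cases h : x < m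
  · exact ⟨x, h.ne, by simp [moveRowToEnd, h]⟩
  · refine ⟨⟨x + 1, hx⟩, ?_, by simp [moveRowToEnd, h, hx]⟩
    rintro rfl
    exact h (by rw [Fin.lt_def]; simp)

theorem moveRowToEnd_apply_last {F : Type*} {k : ℕ} {ι : Type*} (m : Fin k) (M : Matrix (Fin k) ι F)
    (x : Fin k) (hx : (x : ℕ) + 1 = k) : moveRowToEnd m M x = M m := by
  have h1 : ¬ x < m := by rw [Fin.lt_def]; have := m.2; omega
  simp [moveRowToEnd, h1, hx]

theorem isUnit_moveRowToEnd_eliminateBelow_one {k : ℕ} (m : Fin k) (c : Fin k → F) :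
    IsUnit (moveRowToEnd m (eliminateBelow m c (1 : Matrix (Fin k) (Fin k) F))) := by
  rw [← Matrix.mulVec_injective_iff_isUnit]
  intro v w h
  have h1 : moveRowToEnd m (eliminateBelow m c (1 : Matrix (Fin k) (Fin k) F)) *
        Matrix.replicateCol Unit v =
      moveRowToEnd m (eliminateBelow m c (1 : Matrix (Fin k) (Fin k) F)) *
        Matrix.replicateCol Unit w := by
    rw [← Matrix.replicateCol_mulVec, ← Matrix.replicateCol_mulVec, h]
  rw [moveRowToEnd_eliminateBelow_one_mul, moveRowToEnd_eliminateBelow_one_mul] at h1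
  exact Matrix.replicateCol_injective (eliminateBelow_injective m c (moveRowToEnd_injective m h1))

theorem mem_codeSupport_code_iff {k n : ℕ} (B : Matrix (Fin k) (Fin n) F) (j : Fin n) :
    j ∈ codeSupport (code B) ↔ ∃ i, B i j ≠ 0 := by
  constructor
  · rintro ⟨c, hc, hcj⟩
    by_contra! h
    refine hcj ?_
    have : code B ≤ LinearMap.ker (LinearMap.proj (R := F) (φ := fun _ : Fin n => F) j) := by
      refine Submodule.span_le.2 ?_
      rintro _ ⟨i, rfl⟩
      exact h i
    exact this hc
  · rintro ⟨i, hi⟩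
    exact ⟨B i, Submodule.subset_span ⟨i, rfl⟩, hi⟩

theorem isUnit_extendByOne {k i : ℕ} (hi : i ≤ k) {A : Matrix (Fin i) (Fin i) F} (hA : IsUnit A) :
    IsUnit (extendByOne hi A) := by
  rw [Matrix.isUnit_iff_isUnit_det] at hA ⊢
  rw [extendByOne, Matrix.det_reindex_self, Matrix.det_fromBlocks_zero₂₁, Matrix.det_one, mul_one]
  exact hA

theorem extendByOne_mul_apply_castLE {k n i : ℕ} (hi : i ≤ k) (A : Matrix (Fin i) (Fin i) F)
    (B : Matrix (Fin k) (Fin n) F) (x : Fin i) (c : Fin n) :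
    (extendByOne hi A * B) (Fin.castLE hi x) c = ∑ y, A x y * B (Fin.castLE hi y) c := by
  let e : Fin i ⊕ Fin (k - i) ≃ Fin k := finSumFinEquiv.trans (finCongr (Nat.add_sub_cancel' hi))
  have he : ∀ y : Fin i, Fin.castLE hi y = e (Sum.inl y) := fun y => rfl
  rw [Matrix.mul_apply, ← e.sum_comp, Fintype.sum_sum_type]
  simp only [he]
  simp [extendByOne, e]

theorem extendByOne_mul_apply_of_le {k n i : ℕ} (hi : i ≤ k) (A : Matrix (Fin i) (Fin i) F)
    (B : Matrix (Fin k) (Fin n) F) (x : Fin k) (hx : i ≤ x) (c : Fin n) :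
    (extendByOne hi A * B) x c = B x c := by
  let e : Fin i ⊕ Fin (k - i) ≃ Fin k := finSumFinEquiv.trans (finCongr (Nat.add_sub_cancel' hi))
  obtain ⟨z, rfl⟩ : ∃ z : Fin (k - i), x = e (Sum.inr z) :=
    ⟨⟨x - i, by have := x.2; omega⟩, by ext; simp [e]; omega⟩
  rw [Matrix.mul_apply, ← e.sum_comp, Fintype.sum_sum_type]
  simp [extendByOne, e, Matrix.one_apply]

end rowOperations

/-! ### The effect of Backward Reduction on redundant columns. -/

section backwardReduction

variable [DecidableEq F]

variable {sel : ∀ k n : ℕ, Matrix (Fin k) (Fin n) F → Finset (Fin n)}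

theorem isUnit_backwardReduction {k n : ℕ} (B : Matrix (Fin k) (Fin n) F) :
    IsUnit (backwardReduction sel B) := by
  unfold backwardReduction
  split_ifs
  · simp only
    split_ifs
    · exact isUnit_moveRowToEnd_eliminateBelow_one _ _
    · exact isUnit_one
  · exact isUnit_one

theorem leadRow_ne_zero {k n : ℕ} (B : Matrix (Fin k) (Fin n) F) (j : Fin n)
    (h : ∃ i, B i j ≠ 0) : B (leadRow B j h) j ≠ 0 := by
  have := Finset.min'_mem (Finset.univ.filter fun i => B i j ≠ 0)
    (by obtain ⟨i, hi⟩ := h; exact ⟨i, by simpa using hi⟩)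
  exact (Finset.mem_filter.1 this).2

theorem eq_zero_of_lt_leadRow {k n : ℕ} (B : Matrix (Fin k) (Fin n) F) (j : Fin n)
    (h : ∃ i, B i j ≠ 0) (i : Fin k) (hi : i < leadRow B j h) : B i j = 0 := by
  by_contra h0
  exact absurd (Finset.min'_le _ i (by simpa using h0)) (not_le.2 hi)

theorem colScale_ne_zero {k n : ℕ} (B : Matrix (Fin k) (Fin n) F) (j : Fin n)
    (h : ∃ i, B i j ≠ 0) : colScale B j ≠ 0 := by
  rw [colScale, dif_pos h]
  exact inv_ne_zero (leadRow_ne_zero B j h)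

/-- After backward reduction, the columns of the redundant set are supported on the last row. -/
theorem backwardReduction_mul_apply {k n : ℕ} (hsel : IsMaxRedundantSetRule sel)
    (B : Matrix (Fin k) (Fin n) F) (j : Fin n) (hj : j ∈ sel k n B) (x : Fin k) :
    (backwardReduction sel B * B) x j = 0 ↔ (x : ℕ) + 1 < k := by
  obtain ⟨hsupp, heq⟩ := (hsel k n B).1
  have hne : (sel k n B).Nonempty := ⟨j, hj⟩
  set j₁ := (sel k n B).min' hne with hj₁
  have hj₁mem : j₁ ∈ sel k n B := Finset.min'_mem _ _
  have h₁ : ∃ i, B i j₁ ≠ 0 := (mem_codeSupport_code_iff B j₁).1 (hsupp _ hj₁mem)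
  have h₂ : ∃ i, B i j ≠ 0 := (mem_codeSupport_code_iff B j).1 (hsupp _ hj)
  have hred : backwardReduction sel B = moveRowToEnd (leadRow B j₁ h₁)
      (eliminateBelow (leadRow B j₁ h₁)
        (fun i => (B (leadRow B j₁ h₁) j₁)⁻¹ * B i j₁) (1 : Matrix (Fin k) (Fin k) F)) := by
    unfold backwardReduction
    rw [dif_pos hne]
    exact dif_pos h₁
  rw [hred, moveRowToEnd_eliminateBelow_one_mul]
  set m := leadRow B j₁ h₁ with hm
  have hm0 : B m j₁ ≠ 0 := leadRow_ne_zero B j₁ h₁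
  -- All chosen columns are proportional to column `j₁`, so the elimination that clears `j₁` clears
  -- them too.
  obtain ⟨γ, hγ, hγeq⟩ : ∃ γ : F, γ ≠ 0 ∧ ∀ i, B i j = γ * B i j₁ := by
    refine ⟨(colScale B j)⁻¹ * colScale B j₁,
      mul_ne_zero (inv_ne_zero (colScale_ne_zero B j h₂)) (colScale_ne_zero B j₁ h₁), fun i => ?_⟩
    rw [mul_assoc, heq _ hj₁mem _ hj i, inv_mul_cancel_left₀ (colScale_ne_zero B j h₂)]
  constructor
  · intro h
    by_contra hx
    rw [moveRowToEnd_apply_last m _ x (by have := x.2; omega)] at h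
    simp only [eliminateBelow, lt_irrefl, if_false, hγeq] at h
    exact mul_ne_zero hγ hm0 h
  · intro hx
    obtain ⟨i, him, hi⟩ := moveRowToEnd_apply_of_lt m
      (eliminateBelow m (fun i => (B m j₁)⁻¹ * B i j₁) B) x hx
    rw [hi]
    by_cases hmi : m < i
    · simp only [eliminateBelow, hmi, if_true, Pi.sub_apply, Pi.smul_apply, smul_eq_mul, hγeq]
      field_simp
      ring
    · simp only [eliminateBelow, hmi, if_false, hγeq]
      rw [eq_zero_of_lt_leadRow B j₁ h₁ i (lt_of_le_of_ne (not_lt.1 hmi) him), mul_zero]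

/-- Equal nonzero columns have equal scales, so the pair `{a, b}` competes in the maximality of the
selected set. -/
theorem two_le_card_sel {k n : ℕ} (hsel : IsMaxRedundantSetRule sel)
    (B : Matrix (Fin k) (Fin n) F) (a b : Fin n) (hab : a ≠ b) (heq : ∀ i, B i a = B i b)
    (hne : ∃ i, B i a ≠ 0) : 2 ≤ (sel k n B).card := by
  have hne' : ∃ i, B i b ≠ 0 := by simpa only [heq] using hne
  have hlead : leadRow B a hne = leadRow B b hne' := by
    unfold leadRow; simp only [heq]
  have hscale : colScale B a = colScale B b := by
    rw [colScale, colScale, dif_pos hne, dif_pos hne', hlead, heq]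
  rw [← Finset.card_pair hab]
  refine (hsel k n B).2 _ ⟨?_, ?_⟩
  · intro j hj
    rw [mem_codeSupport_code_iff]
    rcases Finset.mem_insert.1 hj with rfl | hj
    · exact hne
    · rw [Finset.mem_singleton.1 hj]; exact hne'
  · intro j₁ h₁ j₂ h₂ i
    simp only [Finset.mem_insert, Finset.mem_singleton] at h₁ h₂
    rcases h₁ with rfl | rfl <;> rcases h₂ with rfl | rfl <;> simp [heq, hscale]

end backwardReduction

/-! ### Columns and rows through the iterations of the loop. -/

section reduceCorner

variable [DecidableEq F]

variable {sel : ∀ k n : ℕ, Matrix (Fin k) (Fin n) F → Finset (Fin n)}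

theorem reduceCorner_apply_of_le {k n : ℕ} (i j : ℕ) (B : Matrix (Fin k) (Fin n) F) (x : Fin k)
    (hx : i ≤ x) (c : Fin n) : reduceCorner sel i j B x c = B x c :=
  extendByOne_mul_apply_of_le _ _ _ _ ((min_le_left i k).trans hx) _

theorem reduceCorner_apply_eq_zero {k n : ℕ} (i j : ℕ) (B : Matrix (Fin k) (Fin n) F) (c : Fin n)
    (r : ℕ) (hi : i ≤ r) (hB : ∀ x : Fin k, (x : ℕ) < r → B x c = 0) (x : Fin k)
    (hx : (x : ℕ) < r) : reduceCorner sel i j B x c = 0 := by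
  by_cases hxi : i ≤ x
  · rw [reduceCorner_apply_of_le i j B x hxi, hB x hx]
  · obtain ⟨y, rfl⟩ : ∃ y : Fin (min i k), x = Fin.castLE (min_le_right i k) y :=
      ⟨⟨x, lt_min (not_le.1 hxi) x.2⟩, rfl⟩
    rw [reduceCorner, extendByOne_mul_apply_castLE]
    refine Finset.sum_eq_zero fun z _ => ?_
    rw [hB, mul_zero]
    have := z.2
    simp only [Fin.val_castLE]
    omega

/-- The loop over `i, …, 1` preserves the rows from `i` on, and the columns that vanish above
row `r ≥ i`. -/
theorem reduceLoop_apply {k n β : ℕ} (i j : ℕ) (B : Matrix (Fin k) (Fin n) F) (c : Fin n)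
    (r : Fin k) (hi : i ≤ r) (hB : ∀ x < r, B x c = 0) :
    (∀ x < r, reduceLoop sel β i j B x c = 0) ∧ reduceLoop sel β i j B r c = B r c := by
  induction i generalizing j B with
  | zero => exact ⟨hB, rfl⟩
  | succ i ih =>
    obtain ⟨h1, h2⟩ := ih (j + β) (reduceCorner sel (i + 1) j B) (by omega)
      (fun x hx => reduceCorner_apply_eq_zero (i + 1) j B c r hi (fun y hy => hB y hy) x hx)
    exact ⟨h1, h2.trans (reduceCorner_apply_of_le _ _ _ _ hi _)⟩

/-- The step of the loop that treats row `r` produces an epipodal vector that is nonzero on the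
selected redundant set. -/
theorem card_sel_le_hammingNorm_epipodal {k n β : ℕ} (hsel : IsMaxRedundantSetRule sel) (j : ℕ)
    (B : Matrix (Fin k) (Fin n) F) (r : Fin k) :
    (sel _ _ (corner (r + 1) j B)).card ≤
      hammingNorm (epipodal (reduceLoop sel β (r + 1) j B) r) := by
  set S := sel _ _ (corner (r + 1) j B) with hS
  have hmin : min ((r : ℕ) + 1) k = r + 1 := min_eq_left r.2
  have hcol : ∀ c ∈ S, ∀ x : Fin k, x ≤ r →
      (reduceCorner sel (r + 1) j B x (Fin.castLE (min_le_right j n) c) = 0 ↔ x < r) := by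
    intro c hc x hx
    rw [Fin.le_def] at hx
    obtain ⟨y, rfl⟩ : ∃ y : Fin (min (r + 1) k), x = Fin.castLE (min_le_right _ k) y :=
      ⟨⟨x, by omega⟩, rfl⟩
    have h := backwardReduction_mul_apply hsel (corner (r + 1) j B) c hc y
    rw [Matrix.mul_apply] at h
    rw [reduceCorner, extendByOne_mul_apply_castLE]
    refine h.trans ?_
    rw [Fin.lt_def]
    simp only [Fin.val_castLE]
    omega
  rw [← Finset.card_map (Fin.castLEEmb (min_le_right j n))]
  refine Finset.card_le_card fun c' hc' => ?_
  obtain ⟨c, hc, rfl⟩ := Finset.mem_map.1 hc'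
  -- The remaining iterations act on rows above `r` only, where the chosen columns are already zero.
  obtain ⟨h1, h2⟩ := reduceLoop_apply (sel := sel) (β := β) r (j + β)
    (reduceCorner sel (r + 1) j B) (Fin.castLE (min_le_right j n) c) r le_rfl
    (fun x hx => (hcol c hc x hx.le).2 hx)
  simp only [Finset.mem_filter, Finset.mem_univ, true_and]
  change epipodal _ r (Fin.castLE (min_le_right j n) c) ≠ 0
  have h3 : epipodal (reduceLoop sel β (r + 1) j B) r (Fin.castLE (min_le_right j n) c) =
      reduceLoop sel β (r + 1) j B r (Fin.castLE (min_le_right j n) c) := if_pos h1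
  rw [h3]
  change reduceLoop sel β r (j + β) (reduceCorner sel (r + 1) j B) r _ ≠ 0
  rw [h2]
  exact fun h => lt_irrefl r ((hcol c hc r le_rfl).1 h)

end reduceCorner


/-! ### Pivot columns and their dependence on leading columns. -/

section pivots

/-- The first `c` columns of `B` span the column space. -/
def LeadingColsSpan {k n : ℕ} (c : ℕ) (B : Matrix (Fin k) (Fin n) F) : Prop :=
  Submodule.span F (B.col '' {j | (j : ℕ) < c}) = ⊤

/-- `B` and `B'` have the same first `c` columns. -/
def AgreeBelow {F : Type*} {k n : ℕ} (c : ℕ) (B B' : Matrix (Fin k) (Fin n) F) : Prop :=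
  ∀ (x : Fin k) (y : Fin n), (y : ℕ) < c → B x y = B' x y

theorem AgreeBelow.col_image_eq {F : Type*} {k n c : ℕ} {B B' : Matrix (Fin k) (Fin n) F}
    (h : AgreeBelow c B B') (s : Set (Fin n)) (hs : ∀ j ∈ s, (j : ℕ) < c) :
    B.col '' s = B'.col '' s :=
  Set.image_congr fun j hj => funext fun x => h x j (hs j hj)

theorem AgreeBelow.mono {F : Type*} {k n c d : ℕ} {B B' : Matrix (Fin k) (Fin n) F}
    (h : AgreeBelow c B B') (hd : d ≤ c) : AgreeBelow d B B' :=
  fun x y hy => h x y (hy.trans_le hd)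

theorem AgreeBelow.mul_left {k n c : ℕ} {B B' : Matrix (Fin k) (Fin n) F}
    (h : AgreeBelow c B B') (G : Matrix (Fin k) (Fin k) F) : AgreeBelow c (G * B) (G * B') := by
  intro x y hy
  simp only [Matrix.mul_apply]
  exact Finset.sum_congr rfl fun z _ => by rw [h z y hy]

theorem AgreeBelow.leadingColsSpan_iff {k n c : ℕ} {B B' : Matrix (Fin k) (Fin n) F}
    (h : AgreeBelow c B B') : LeadingColsSpan c B ↔ LeadingColsSpan c B' := by
  unfold LeadingColsSpan
  rw [h.col_image_eq {j | (j : ℕ) < c} fun j hj => hj]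

theorem linearIndepOn_of_notMem_span {k n : ℕ} (B : Matrix (Fin k) (Fin n) F)
    (S : Finset (Fin n))
    (hS : ∀ j ∈ S, B.col j ∉ Submodule.span F (B.col '' {j' | j' < j})) :
    LinearIndepOn F B.col (S : Set (Fin n)) := by
  induction S using Finset.induction_on_max with
  | empty => simp
  | insert a S ha ih =>
    rw [Finset.coe_insert]
    refine (ih fun j hj => hS j (Finset.mem_insert_of_mem hj)).insert fun h => ?_
    exact hS a (Finset.mem_insert_self a S) (Submodule.span_mono (Set.image_mono ha) h)

theorem mem_pivotCols {k n : ℕ} {B : Matrix (Fin k) (Fin n) F} {j : Fin n} :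
    j ∈ pivotCols B ↔ B.col j ∉ Submodule.span F (B.col '' {j' | j' < j}) := by
  simp [pivotCols]

theorem linearIndepOn_pivotCols {k n : ℕ} (B : Matrix (Fin k) (Fin n) F) :
    LinearIndepOn F B.col (pivotCols B : Set (Fin n)) :=
  linearIndepOn_of_notMem_span B _ fun _ hj => mem_pivotCols.1 hj

theorem col_mem_span_pivotCols {k n : ℕ} (B : Matrix (Fin k) (Fin n) F) (j : Fin n) :
    B.col j ∈ Submodule.span F (B.col '' (pivotCols B : Set (Fin n))) := by
  induction j using WellFoundedLT.induction with
  | ind j ih =>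
    by_cases hj : j ∈ pivotCols B
    · exact Submodule.subset_span ⟨j, hj, rfl⟩
    · rw [mem_pivotCols, not_not] at hj
      refine Submodule.span_le.2 ?_ hj
      rintro _ ⟨i, hi, rfl⟩
      exact ih i hi

theorem LeadingColsSpan.lt_of_mem_pivotCols {k n c : ℕ} {B : Matrix (Fin k) (Fin n) F}
    (h : LeadingColsSpan c B) {j : Fin n} (hj : j ∈ pivotCols B) : (j : ℕ) < c := by
  by_contra hc
  refine mem_pivotCols.1 hj ?_
  have : (⊤ : Submodule F (Fin k → F)) ≤ Submodule.span F (B.col '' {j' | j' < j}) := by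
    rw [← h]
    refine Submodule.span_mono (Set.image_mono fun i hi => ?_)
    exact Fin.lt_def.2 (lt_of_lt_of_le hi (not_lt.1 hc))
  exact this Submodule.mem_top

theorem LeadingColsSpan.card_pivotCols {k n c : ℕ} {B : Matrix (Fin k) (Fin n) F}
    (h : LeadingColsSpan c B) : (pivotCols B).card = k := by
  have hspan : ⊤ ≤ Submodule.span F (Set.range fun j : (pivotCols B : Set (Fin n)) => B.col j) := by
    rw [← h, Submodule.span_le]
    rintro _ ⟨j, -, rfl⟩
    have := col_mem_span_pivotCols B j
    rwa [Set.image_eq_range] at this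
  have := Module.finrank_eq_card_basis (Module.Basis.mk (linearIndepOn_pivotCols B) hspan)
  simpa using this.symm

theorem isUnit_submatrix_pivotCols {k n : ℕ} (B : Matrix (Fin k) (Fin n) F)
    (h : (pivotCols B).card = k) :
    IsUnit (B.submatrix id ((pivotCols B).orderEmbOfFin h)) := by
  rw [← Matrix.linearIndependent_cols_iff_isUnit]
  exact (linearIndepOn_pivotCols B).linearIndependent.comp
    (fun x => ⟨(pivotCols B).orderEmbOfFin h x, Finset.orderEmbOfFin_mem _ h x⟩)
    fun x y hxy => ((pivotCols B).orderEmbOfFin h).injective (congrArg Subtype.val hxy)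

theorem AgreeBelow.pivotCols_eq {k n c : ℕ} {B B' : Matrix (Fin k) (Fin n) F}
    (h : AgreeBelow c B B') (hB : LeadingColsSpan c B) : pivotCols B = pivotCols B' := by
  ext j
  by_cases hj : (j : ℕ) < c
  · have h1 : B.col j = B'.col j := funext fun x => h x j hj
    have h2 := h.col_image_eq {j' | j' < j} fun i hi => lt_trans (Fin.lt_def.1 hi) hj
    rw [mem_pivotCols, mem_pivotCols, h1, h2]
  · exact ⟨fun h' => absurd (hB.lt_of_mem_pivotCols h') hj,
      fun h' => absurd ((h.leadingColsSpan_iff.1 hB).lt_of_mem_pivotCols h') hj⟩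

/-- The matrix on which the loop of Selective Backward Reduction starts. -/
noncomputable def initialState {k n : ℕ} (B : Matrix (Fin k) (Fin n) F) :
    Matrix (Fin k) (Fin n) F :=
  if h : (pivotCols B).card = k then systematize B (pivotCols B) h else B

/-- All pivots lie among the first `c` columns, so both matrices are systematized by the same
inverse. -/
theorem AgreeBelow.exists_isUnit_initialState {k n c : ℕ} {B B' : Matrix (Fin k) (Fin n) F}
    (h : AgreeBelow c B B') (hB : LeadingColsSpan c B) :
    ∃ G : Matrix (Fin k) (Fin k) F, IsUnit G ∧ initialState B = G * B ∧
      initialState B' = G * B' := by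
  have hS := hB.card_pivotCols
  have hpiv := h.pivotCols_eq hB
  have hS' : (pivotCols B').card = k := hpiv ▸ hS
  refine ⟨(B.submatrix id ((pivotCols B).orderEmbOfFin hS))⁻¹,
    (Matrix.isUnit_nonsing_inv_iff).2 (isUnit_submatrix_pivotCols B hS), ?_, ?_⟩
  · rw [initialState, dif_pos hS, systematize]
  · rw [initialState, dif_pos hS', systematize]
    have : B'.submatrix id ((pivotCols B').orderEmbOfFin hS') =
        B.submatrix id ((pivotCols B).orderEmbOfFin hS) := by
      ext x y
      simp only [Matrix.submatrix_apply, id]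
      simp only [← hpiv]
      exact (h _ _ (hB.lt_of_mem_pivotCols (Finset.orderEmbOfFin_mem _ hS y))).symm
    rw [this]

end pivots

/-! ### Intermediate matrices and the independence of fresh columns. -/

section states

variable [DecidableEq F] {sel : ∀ k n : ℕ, Matrix (Fin k) (Fin n) F → Finset (Fin n)}

theorem selectiveBackwardReduction_eq_some {k n β : ℕ} {B : Matrix (Fin k) (Fin n) F}
    (h : LeadingColsSpan (k + β) B) :
    selectiveBackwardReduction sel β B =
      some (reduceLoop sel β ((n - k) / β - 1) (k + 2 * β) (initialState B)) := by
  rw [selectiveBackwardReduction, dif_pos ⟨h.card_pivotCols, fun j hj => h.lt_of_mem_pivotCols hj⟩,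
    initialState, dif_pos h.card_pivotCols]

/-- The matrix after `s` iterations of the loop started with `i`, `j` and `B`. -/
def loopState (sel : ∀ k n : ℕ, Matrix (Fin k) (Fin n) F → Finset (Fin n)) {k n : ℕ}
    (β i j : ℕ) (B : Matrix (Fin k) (Fin n) F) : ℕ → Matrix (Fin k) (Fin n) F
  | 0 => B
  | s + 1 => reduceCorner sel (i - s) (j + s * β) (loopState sel β i j B s)

theorem reduceLoop_eq_reduceLoop_loopState {k n : ℕ} (β i j : ℕ) (B : Matrix (Fin k) (Fin n) F)
    (s : ℕ) (hs : s ≤ i) :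
    reduceLoop sel β i j B =
      reduceLoop sel β (i - s) (j + s * β) (loopState sel β i j B s) := by
  induction s with
  | zero => simp [loopState]
  | succ s ih =>
    rw [ih (by omega)]
    obtain ⟨t, ht⟩ : ∃ t, i - s = t + 1 := ⟨i - s - 1, by omega⟩
    rw [loopState, ht, show i - (s + 1) = t by omega, reduceLoop, add_mul, one_mul, add_assoc]

/-- The bound on `j + t * β` keeps every corner inspected so far inside the common columns, so both
runs perform the same row operations. -/
theorem exists_isUnit_loopState {k n β i j c : ℕ} {M M' : Matrix (Fin k) (Fin n) F}
    (h : AgreeBelow c M M') (s : ℕ) (hs : ∀ t < s, j + t * β ≤ c) :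
    ∃ G : Matrix (Fin k) (Fin k) F, IsUnit G ∧ loopState sel β i j M s = G * M ∧
      loopState sel β i j M' s = G * M' := by
  induction s with
  | zero => exact ⟨1, isUnit_one, by simp [loopState], by simp [loopState]⟩
  | succ s ih =>
    obtain ⟨G, hG, h1, h2⟩ := ih fun t ht => hs t (by omega)
    have hcorner : corner (i - s) (j + s * β) (G * M) = corner (i - s) (j + s * β) (G * M') := by
      ext x y
      refine h.mul_left G _ _ ?_
      have := y.2
      have := hs s (by omega)
      simp only [Fin.val_castLE]
      omega
    refine ⟨extendByOne (min_le_right _ k)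
      (backwardReduction sel (corner (i - s) (j + s * β) (G * M))) * G,
      (isUnit_extendByOne _ (isUnit_backwardReduction _)).mul hG, ?_, ?_⟩
    · rw [loopState, h1, reduceCorner, Matrix.mul_assoc]
    · rw [loopState, h2, reduceCorner, Matrix.mul_assoc, hcorner]

/-- The matrix after `s` iterations of the loop of Selective Backward Reduction. -/
noncomputable def stateAfter (sel : ∀ k n : ℕ, Matrix (Fin k) (Fin n) F → Finset (Fin n))
    {k n : ℕ} (β s : ℕ) (B : Matrix (Fin k) (Fin n) F) : Matrix (Fin k) (Fin n) F :=
  loopState sel β ((n - k) / β - 1) (k + 2 * β) (initialState B) s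

/-- The offset is exact: for `s ≥ 1` the last corner used has width parameter `k + 2β + (s - 1)β = k
+ β + sβ`. -/
theorem exists_isUnit_stateAfter {k n β s : ℕ} {B B' : Matrix (Fin k) (Fin n) F}
    (h : AgreeBelow (k + β + s * β) B B') (hB : LeadingColsSpan (k + β) B) :
    ∃ G : Matrix (Fin k) (Fin k) F, IsUnit G ∧ stateAfter sel β s B = G * B ∧
      stateAfter sel β s B' = G * B' := by
  obtain ⟨G, hG, h1, h2⟩ := (h.mono (by omega)).exists_isUnit_initialState hB
  obtain ⟨H, hH, h3, h4⟩ := exists_isUnit_loopState (sel := sel) (β := β)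
    (i := (n - k) / β - 1) (j := k + 2 * β) (h.mul_left G) s (fun t ht => by nlinarith)
  exact ⟨H * G, hH.mul hG, by rw [stateAfter, h1, h3, Matrix.mul_assoc],
    by rw [stateAfter, h2, h4, Matrix.mul_assoc]⟩

open Classical in
/-- Replace the columns `c, …, c + β - 1`, with `c = k + β + s * β`, by those of the matrix
after `s` iterations. -/
noncomputable def replaceBlock (sel : ∀ k n : ℕ, Matrix (Fin k) (Fin n) F → Finset (Fin n))
    {k n : ℕ} (β s : ℕ) (B : Matrix (Fin k) (Fin n) F) : Matrix (Fin k) (Fin n) F :=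
  fun x y => if LeadingColsSpan (k + β) B ∧ k + β + s * β ≤ y ∧ (y : ℕ) < k + β + s * β + β then
    stateAfter sel β s B x y else B x y

/-- The columns before the block are unchanged, and they determine both whether the leading columns
span and the invertible matrix `G` applied to the block; hence the replacement can be undone. -/
theorem replaceBlock_injective {k n : ℕ} (β s : ℕ) :
    Function.Injective (replaceBlock sel (k := k) (n := n) β s) := by
  intro B B' h
  have hout : ∀ x (y : Fin n),
      ¬ (k + β + s * β ≤ y ∧ (y : ℕ) < k + β + s * β + β) → B x y = B' x y := by
    intro x y hy
    have := congrFun (congrFun h x) y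
    simpa only [replaceBlock, hy, and_false, if_false] using this
  have hagree : AgreeBelow (k + β + s * β) B B' := fun x y hy => hout x y (by omega)
  have hiff := (hagree.mono (d := k + β) (by omega)).leadingColsSpan_iff
  by_cases hB : LeadingColsSpan (k + β) B
  · obtain ⟨G, hG, h1, h2⟩ := exists_isUnit_stateAfter (sel := sel) hagree hB
    have hdet := (Matrix.isUnit_iff_isUnit_det G).1 hG
    suffices hmul : G * B = G * B' by
      rw [← Matrix.nonsing_inv_mul_cancel_left G B hdet, hmul,
        Matrix.nonsing_inv_mul_cancel_left G B' hdet]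
    ext x y
    by_cases hy : k + β + s * β ≤ y ∧ (y : ℕ) < k + β + s * β + β
    · have := congrFun (congrFun h x) y
      simpa only [replaceBlock, hB, hiff.1 hB, hy, true_and, and_self, if_true, h1, h2] using this
    · simp only [Matrix.mul_apply]
      exact Finset.sum_congr rfl fun z _ => by rw [hout z y hy]
  · ext x y
    have := congrFun (congrFun h x) y
    simpa only [replaceBlock, hB, mt hiff.2 hB, false_and, if_false] using this

end states


/-! ### Probability of rank failure and of a missing collision. -/

section probability

theorem exists_dotProduct_eq_zero_of_not_leadingColsSpan {k n c : ℕ}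
    {B : Matrix (Fin k) (Fin n) F} (h : ¬ LeadingColsSpan c B) :
    ∃ y : Fin k → F, y ≠ 0 ∧ ∀ j : Fin n, (j : ℕ) < c → ∑ x, y x * B x j = 0 := by
  obtain ⟨f, hf, hle⟩ := Submodule.exists_le_ker_of_lt_top _ (lt_top_iff_ne_top.2 h)
  have hfy : ∀ v : Fin k → F, f v = ∑ x, f (Pi.single x 1) * v x := by
    intro v
    conv_lhs => rw [pi_eq_sum_univ' v]
    simp only [map_sum, map_smul, smul_eq_mul]
    exact Finset.sum_congr rfl fun x _ => mul_comm _ _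
  refine ⟨fun x => f (Pi.single x 1), fun h0 => hf ?_, fun j hj => ?_⟩
  · ext x
    simpa using congrFun h0 x
  · rw [← hfy fun x => B x j]
    exact hle (Submodule.subset_span ⟨j, hj, rfl⟩)

theorem density_not_leadingColsSpan_le [Fintype F] {k n β : ℕ} (hn : k + β ≤ n) :
    density {B : Matrix (Fin k) (Fin n) F | ¬ LeadingColsSpan (k + β) B} ≤
      ((Fintype.card F : ℝ) ^ β)⁻¹ := by
  classical
  let E : (Fin k → F) → Set (Matrix (Fin k) (Fin n) F) := fun y =>
    {B | ∀ j : Fin n, (j : ℕ) < k + β → ∑ x, y x * B x j = 0}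
  have hsub : {B : Matrix (Fin k) (Fin n) F | ¬ LeadingColsSpan (k + β) B} ⊆
      ⋃ y ∈ Finset.univ.filter (fun y : Fin k → F => y ≠ 0), E y := by
    intro B hB
    obtain ⟨y, hy, h⟩ := exists_dotProduct_eq_zero_of_not_leadingColsSpan hB
    simp only [Set.mem_iUnion]
    exact ⟨y, by simpa using hy, h⟩
  -- A nonzero coordinate of `y` makes the map sending `B` to the first `k + β` entries of `y B`
  -- surjective, so these entries are uniform.
  have hE : ∀ y : Fin k → F, y ≠ 0 → density (E y) = ((Fintype.card F : ℝ) ^ (k + β))⁻¹ := by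
    intro y hy
    obtain ⟨x₀, hx₀⟩ := Function.ne_iff.1 hy
    let f : Matrix (Fin k) (Fin n) F →+ (Fin (k + β) → F) :=
      { toFun := fun B j => ∑ x, y x * B x (Fin.castLE hn j)
        map_zero' := by ext; simp
        map_add' := fun A B => by ext; simp [mul_add, Finset.sum_add_distrib] }
    have hf : Function.Surjective f := by
      intro w
      refine ⟨fun x j => if h : x = x₀ ∧ (j : ℕ) < k + β then (y x₀)⁻¹ * w ⟨j, h.2⟩ else 0, ?_⟩
      funext j
      change ∑ x, y x * _ = _
      rw [Finset.sum_eq_single x₀]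
      · simp only [Fin.val_castLE, j.2, and_self, dif_pos]
        exact mul_inv_cancel_left₀ hx₀ _
      · intro x _ hx
        simp [hx]
      · simp
    have hEf : E y = f ⁻¹' {0} := by
      ext B
      simp only [E, Set.mem_ofPred_eq, Set.mem_preimage, Set.mem_singleton_iff]
      constructor
      · intro h
        funext j
        exact h _ j.2
      · intro h j hj
        exact congrFun h ⟨j, hj⟩
    rw [hEf, density_preimage_of_surjective f hf, density, Set.ncard_singleton,
      Nat.card_eq_fintype_card, Fintype.card_fun, Fintype.card_fin]
    push_cast
    rw [one_div]
  have hq : (0 : ℝ) < Fintype.card F := by exact_mod_cast Fintype.card_pos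
  calc density {B : Matrix (Fin k) (Fin n) F | ¬ LeadingColsSpan (k + β) B}
      ≤ ∑ y ∈ Finset.univ.filter (fun y : Fin k → F => y ≠ 0), density (E y) :=
        (density_mono hsub).trans (density_biUnion_le _ _)
    _ = ∑ y ∈ Finset.univ.filter (fun y : Fin k → F => y ≠ 0),
          ((Fintype.card F : ℝ) ^ (k + β))⁻¹ :=
        Finset.sum_congr rfl fun y hy => hE y (Finset.mem_filter.1 hy).2
    _ ≤ ∑ y : Fin k → F, ((Fintype.card F : ℝ) ^ (k + β))⁻¹ :=
        Finset.sum_le_sum_of_subset_of_nonneg (Finset.filter_subset _ _) fun _ _ _ => by positivity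
    _ = ((Fintype.card F : ℝ) ^ β)⁻¹ := by
        rw [Finset.sum_const, Finset.card_univ, Fintype.card_fun, Fintype.card_fin, nsmul_eq_mul,
          pow_add]
        push_cast
        field_simp

variable [DecidableEq F] {sel : ∀ k n : ℕ, Matrix (Fin k) (Fin n) F → Finset (Fin n)}

/-- By `hs`, row `r` is treated after `s` iterations. The corner then has width `k + 2β + sβ` and so
ends with the fresh block, where a collision supplies two equal nonzero columns. -/
theorem two_le_hammingNorm_of_not_injectiveOffZero {k n β s : ℕ}
    (hsel : IsMaxRedundantSetRule sel) (B : Matrix (Fin k) (Fin n) F) (r : Fin k)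
    (hs : r + 1 + s = (n - k) / β - 1) (hn : k + β + s * β + β ≤ n)
    (hinj : ¬ InjectiveOffZero fun (a : Fin β) (x : Fin (r + 1)) =>
      stateAfter sel β s B (Fin.castLE r.2 x) ⟨k + β + s * β + a, by omega⟩) :
    2 ≤ hammingNorm (epipodal
      (reduceLoop sel β ((n - k) / β - 1) (k + 2 * β) (initialState B)) r) := by
  rw [reduceLoop_eq_reduceLoop_loopState _ _ _ _ s (by omega),
    show (n - k) / β - 1 - s = r + 1 by omega]
  refine le_trans ?_ (card_sel_le_hammingNorm_epipodal hsel _ _ r)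
  change 2 ≤ (sel _ _ (corner (r + 1) _ (stateAfter sel β s B))).card
  unfold InjectiveOffZero at hinj
  push Not at hinj
  obtain ⟨a, b, heq, hne, hab⟩ := hinj
  obtain ⟨x, hx⟩ := Function.ne_iff.1 hne
  have hr := r.2
  refine two_le_card_sel hsel _ ⟨k + β + s * β + a, by omega⟩ ⟨k + β + s * β + b, by omega⟩
    (fun h => hab (Fin.ext (by simpa using h))) (fun i => ?_) ⟨⟨x, by omega⟩, hx⟩
  exact congrFun heq ⟨i, by omega⟩

/-- `replaceBlock` carries this event into an event about the plain entries of one block; `f` reads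
off those entries, which are uniform. -/
theorem density_injectiveOffZero_stateAfter_le [Fintype F] {k n β s : ℕ} (hβ : 7 ≤ β) (r : Fin k)
    (hn : k + β + s * β + β ≤ n) :
    density {B : Matrix (Fin k) (Fin n) F | LeadingColsSpan (k + β) B ∧
      InjectiveOffZero fun (a : Fin β) (x : Fin (r + 1)) =>
        stateAfter sel β s B (Fin.castLE r.2 x) ⟨k + β + s * β + a, by omega⟩} ≤
      2 ^ (-(β : ℝ) / 20) + 2 ^ (-((β : ℝ) ^ 2) / (20 * (Fintype.card F : ℝ) ^ ((r : ℕ) + 1))) := by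
  classical
  let f : Matrix (Fin k) (Fin n) F →+ (Fin β → Fin (r + 1) → F) :=
    { toFun := fun B a x => B (Fin.castLE r.2 x) ⟨k + β + s * β + a, by omega⟩
      map_zero' := rfl
      map_add' := fun _ _ => rfl }
  have hf : Function.Surjective f := by
    intro w
    refine ⟨fun x y => if h : (x : ℕ) < r + 1 ∧ (y : ℕ) - (k + β + s * β) < β then
      w ⟨_, h.2⟩ ⟨x, h.1⟩ else 0, ?_⟩
    funext a x
    have h : ((Fin.castLE r.2 x : Fin k) : ℕ) < r + 1 ∧
        (k + β + s * β + a) - (k + β + s * β) < β := ⟨x.2, by omega⟩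
    refine (dif_pos h).trans ?_
    have ha : (⟨_, h.2⟩ : Fin β) = a := Fin.ext (Nat.add_sub_cancel_left _ _)
    exact congrFun (congrArg w ha) x
  have hsub : {B : Matrix (Fin k) (Fin n) F | LeadingColsSpan (k + β) B ∧
      InjectiveOffZero fun (a : Fin β) (x : Fin (r + 1)) =>
        stateAfter sel β s B (Fin.castLE r.2 x) ⟨k + β + s * β + a, by omega⟩} ⊆
      replaceBlock sel β s ⁻¹' (f ⁻¹' {v | InjectiveOffZero v}) := by
    rintro B ⟨hB, hinj⟩
    have : f (replaceBlock sel β s B) = fun (a : Fin β) (x : Fin (r + 1)) =>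
        stateAfter sel β s B (Fin.castLE r.2 x) ⟨k + β + s * β + a, by omega⟩ := by
      funext a x
      exact if_pos ⟨hB, by simp, by simp⟩
    rw [Set.mem_preimage, Set.mem_preimage, Set.mem_ofPred_eq, this]
    exact hinj
  refine (density_mono hsub).trans
    ((density_preimage_le_of_injective (replaceBlock_injective β s) _).trans ?_)
  rw [density_preimage_of_surjective f hf]
  have := density_injectiveOffZero_le (ι := Fin β) (V := Fin (r + 1) → F) (by simpa using hβ)
  rw [Fintype.card_fun, Fintype.card_fin, Fintype.card_fin] at this
  push_cast at this
  exact this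

end probability

/-! ### Numerical estimates. -/

section numerics

theorem sum_range_pow_sub_le {x : ℝ} (h0 : 0 ≤ x) (h1 : x ≤ 1 / 2) (I : ℕ) :
    ∑ r ∈ Finset.range I, x ^ (I - r) ≤ 2 * x := by
  have h2 : ∑ r ∈ Finset.range I, x ^ (I - r) = x * ∑ d ∈ Finset.range I, x ^ d := by
    rw [← Finset.sum_range_reflect, Finset.mul_sum]
    refine Finset.sum_congr rfl fun d hd => ?_
    have := Finset.mem_range.1 hd
    rw [← pow_succ']
    congr 1
    omega
  have h3 := geom_sum_mul_neg x I
  have h4 : 0 ≤ x ^ I := by positivity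
  have h5 : 0 ≤ ∑ d ∈ Finset.range I, x ^ d := Finset.sum_nonneg fun _ _ => by positivity
  have h6 : ∑ d ∈ Finset.range I, x ^ d ≤ 2 := by nlinarith
  rw [h2]
  nlinarith

/-- Lets the rank failure be absorbed by the slack `logb q 20` in the number of rows. One factor
`1/q` is at most `logb q 20`, since `log q ≤ q` and `log 20 ≥ 1`; the others give the power of `2`.
-/
theorem inv_pow_le_logb_mul {q β : ℕ} (hq : 2 ≤ q) (hβ : 7 ≤ β) :
    ((q : ℝ) ^ β)⁻¹ ≤ Real.logb q 20 * 2 ^ (-(β : ℝ) / 20) := by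
  have hq' : (2 : ℝ) ≤ q := by exact_mod_cast hq
  have hβ' : (7 : ℝ) ≤ β := by exact_mod_cast hβ
  have hlogq : 0 < Real.log q := Real.log_pos (by linarith)
  have h20 : 1 ≤ Real.log 20 := by
    rw [Real.le_log_iff_exp_le (by norm_num)]
    linarith [Real.exp_one_lt_d9]
  have h1 : (q : ℝ)⁻¹ ≤ Real.logb q 20 := by
    rw [Real.logb, inv_eq_one_div]
    have := Real.log_le_self (x := (q : ℝ)) (by linarith)
    gcongr
  have h2 : ((q : ℝ) ^ (β - 1))⁻¹ ≤ 2 ^ (-(β : ℝ) / 20) := by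
    have h3 : ((q : ℝ) ^ (β - 1))⁻¹ ≤ ((2 : ℝ) ^ (β - 1))⁻¹ := by gcongr
    refine h3.trans ?_
    rw [← Real.rpow_natCast, ← Real.rpow_neg (by norm_num), Nat.cast_sub (by omega)]
    refine Real.rpow_le_rpow_of_exponent_le (by norm_num) ?_
    push_cast
    linarith
  have h4 : ((q : ℝ) ^ β)⁻¹ = (q : ℝ)⁻¹ * ((q : ℝ) ^ (β - 1))⁻¹ := by
    rw [← mul_inv, ← pow_succ', show β - 1 + 1 = β by omega]
  rw [h4]
  exact mul_le_mul h1 h2 (by positivity) (le_trans (by positivity) h1)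

/-- With `L = logb 2 (2 / ε)`, the choice of `I` gives `20 L q ^ I ≤ β ^ 2` when `I > 0`. The
collision term for row `r` is then at most `2 ^ (-L q ^ (I - r - 1)) ≤ (ε / 2) ^ (I - r)`, and these
sum geometrically to at most `ε`. -/
theorem failure_sum_le {q β : ℕ} (hq : 2 ≤ q) (hβ : 7 ≤ β) {ε : ℝ} (hε0 : 0 < ε) (hε1 : ε < 1)
    {I : ℕ} (hI : I = ⌊2 * Real.logb q β - Real.logb q (20 * Real.logb 2 (2 / ε))⌋₊) :
    ((q : ℝ) ^ β)⁻¹ + ∑ r ∈ Finset.range I,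
      ((2 : ℝ) ^ (-(β : ℝ) / 20) + 2 ^ (-((β : ℝ) ^ 2) / (20 * (q : ℝ) ^ (r + 1)))) ≤
      Real.logb q β * 2 ^ (1 - (β : ℝ) / 20) + ε := by
  have hq' : (2 : ℝ) ≤ q := by exact_mod_cast hq
  have hq1 : (1 : ℝ) < q := by linarith
  have hβ' : (7 : ℝ) ≤ β := by exact_mod_cast hβ
  set L := Real.logb 2 (2 / ε) with hL
  have hL1 : 1 ≤ L := by
    rw [hL, Real.le_logb_iff_rpow_le (by norm_num) (by positivity), Real.rpow_one,
      le_div_iff₀ hε0]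
    linarith
  have h2L : (2 : ℝ) ^ (-L) = ε / 2 := by
    rw [Real.rpow_neg (by norm_num), hL, Real.rpow_logb (by norm_num) (by norm_num) (by positivity),
      inv_div]
  have hlog20 : Real.logb q 20 ≤ Real.logb q (20 * L) :=
    Real.logb_le_logb_of_le hq1 (by norm_num) (by linarith)
  -- If the threshold is negative then `I = 0`, and the claim becomes `20 ≤ β ^ 2`.
  have hIle : (I : ℝ) ≤ 2 * Real.logb q β - Real.logb q 20 := by
    rcases le_total 0 (2 * Real.logb q β - Real.logb q (20 * L)) with h | h
    · rw [hI]
      exact (Nat.floor_le h).trans (by linarith)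
    · rw [hI, Nat.floor_of_nonpos h, Nat.cast_zero, sub_nonneg, two_mul,
        ← Real.logb_mul (by positivity) (by positivity)]
      exact Real.logb_le_logb_of_le hq1 (by norm_num) (by nlinarith)
  have hterm : ∀ r ∈ Finset.range I,
      (2 : ℝ) ^ (-((β : ℝ) ^ 2) / (20 * (q : ℝ) ^ (r + 1))) ≤ (ε / 2) ^ (I - r) := by
    intro r hr
    have hrI := Finset.mem_range.1 hr
    have hX : (I : ℝ) ≤ 2 * Real.logb q β - Real.logb q (20 * L) := by
      rw [hI]
      refine Nat.floor_le (le_of_not_gt fun h => ?_)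
      rw [Nat.floor_of_nonpos h.le] at hI
      omega
    have hpow : (q : ℝ) ^ I * (20 * L) ≤ (β : ℝ) ^ 2 := by
      rw [← Real.logb_le_logb hq1 (by positivity) (by positivity),
        Real.logb_mul (by positivity) (by positivity), Real.logb_pow, Real.logb_pow,
        Real.logb_self_eq_one hq1]
      push_cast
      linarith
    rw [← h2L, ← Real.rpow_mul_natCast (by norm_num)]
    refine Real.rpow_le_rpow_of_exponent_le (by norm_num) ?_
    have hsplit : (q : ℝ) ^ I = q ^ (I - r - 1) * q ^ (r + 1) := by
      rw [← pow_add]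
      congr 1
      omega
    have hd : ((I - r : ℕ) : ℝ) ≤ (q : ℝ) ^ (I - r - 1) := by
      have := Nat.lt_pow_self (n := I - r - 1) hq
      exact_mod_cast (show I - r ≤ q ^ (I - r - 1) by omega)
    have hQ : (0 : ℝ) < q ^ (r + 1) := by positivity
    rw [neg_div, neg_mul, neg_le_neg_iff, le_div_iff₀ (by positivity)]
    calc L * ((I - r : ℕ) : ℝ) * (20 * (q : ℝ) ^ (r + 1))
        ≤ L * (q : ℝ) ^ (I - r - 1) * (20 * (q : ℝ) ^ (r + 1)) := by gcongr
      _ = q ^ I * (20 * L) := by rw [hsplit]; ring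
      _ ≤ _ := hpow
  have hsum2 := (Finset.sum_le_sum hterm).trans
    (sum_range_pow_sub_le (x := ε / 2) (by linarith) (by linarith) I)
  have hinv := inv_pow_le_logb_mul hq hβ
  rw [Finset.sum_add_distrib, Finset.sum_const, Finset.card_range, nsmul_eq_mul]
  have hexp : (2 : ℝ) ^ (1 - (β : ℝ) / 20) = 2 * 2 ^ (-(β : ℝ) / 20) := by
    rw [sub_eq_add_neg, Real.rpow_add (by norm_num), Real.rpow_one, neg_div]
  have hpos : (0 : ℝ) < 2 ^ (-(β : ℝ) / 20) := by positivity
  rw [hexp]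
  nlinarith [mul_le_mul_of_nonneg_right hIle hpos.le]

/-- The loop is long enough to treat every row that the theorem speaks about. -/
theorem succ_le_of_le_logb {q k n β r : ℕ} (hq : 2 ≤ q) (hkn : k ≤ n) (hdvd : β ∣ n - k)
    (hβ : 7 ≤ β)
    (hβn : (β : ℝ) ≤ ((n : ℝ) - k) / (2 * Real.logb q ((n : ℝ) - k) + 1)) {ε : ℝ} (hε0 : 0 < ε)
    (hε1 : ε < 1)
    (hr : (r : ℝ) + 1 ≤ 2 * Real.logb q β - Real.logb q (20 * Real.logb 2 (2 / ε))) :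
    r + 1 + 1 ≤ (n - k) / β := by
  have hq1 : (1 : ℝ) < q := by exact_mod_cast hq
  have hβ' : (7 : ℝ) ≤ β := by exact_mod_cast hβ
  obtain ⟨N, hN⟩ := hdvd
  rw [← Nat.cast_sub hkn] at hβn
  set d := n - k
  have hd : d ≠ 0 := by
    rintro h
    rw [h] at hβn
    simp at hβn
    omega
  have hβd : β ≤ d := Nat.le_of_dvd (Nat.pos_of_ne_zero hd) ⟨N, hN⟩
  have hβd' : (β : ℝ) ≤ d := by exact_mod_cast hβd
  have hlogd : 0 ≤ Real.logb q d := Real.logb_nonneg hq1 (by linarith)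
  have hlogβ : Real.logb q β ≤ Real.logb q d := Real.logb_le_logb_of_le hq1 (by linarith) hβd'
  have hL1 : 1 ≤ Real.logb 2 (2 / ε) := by
    rw [Real.le_logb_iff_rpow_le (by norm_num) (by positivity), Real.rpow_one, le_div_iff₀ hε0]
    linarith
  have hlogL : 0 ≤ Real.logb q (20 * Real.logb 2 (2 / ε)) := Real.logb_nonneg hq1 (by linarith)
  have hNd : (d : ℝ) = β * N := by exact_mod_cast hN
  rw [le_div_iff₀ (by positivity)] at hβn
  -- Divide `β (2 log_q d + 1) ≤ d = β N` by `β`; here `N` exceeds the number of iterations by one.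
  have h1 : 2 * Real.logb q d + 1 ≤ N := by
    refine le_of_mul_le_mul_left ?_ (show (0 : ℝ) < β by linarith)
    linarith
  rw [hN, Nat.mul_div_cancel_left _ (by omega)]
  have h2 : (r : ℝ) + 1 + 1 ≤ N := by linarith
  exact_mod_cast h2

theorem add_le_of_le_div_logb {q k n β : ℕ} (hkn : k ≤ n) (hdvd : β ∣ n - k) (hβ : 7 ≤ β)
    (hβn : (β : ℝ) ≤ ((n : ℝ) - k) / (2 * Real.logb q ((n : ℝ) - k) + 1)) : k + β ≤ n := by
  have hd : n - k ≠ 0 := by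
    intro h
    have hnk : n = k := by omega
    rw [hnk, sub_self, zero_div] at hβn
    have : (7 : ℝ) ≤ β := by exact_mod_cast hβ
    linarith
  have := Nat.le_of_dvd (Nat.pos_of_ne_zero hd) hdvd
  omega

end numerics

end CodeReduction

/-! ### Assembly of the union bound. -/

theorem mainTheorem3 {F : Type*} [Field F] [Fintype F] [DecidableEq F]
    (sel : ∀ k n : ℕ, Matrix (Fin k) (Fin n) F → Finset (Fin n))
    (hsel : CodeReduction.IsMaxRedundantSetRule sel)
    (q k n β : ℕ) (hq : q = Fintype.card F) (hkn : k ≤ n) (hdvd : β ∣ n - k)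
    (hβ : 7 ≤ β)
    (hβn : (β : ℝ) ≤ ((n : ℝ) - k) / (2 * Real.logb q ((n : ℝ) - k) + 1))
    (ε : ℝ) (hε0 : 0 < ε) (hε1 : ε < 1) :
    1 - Real.logb q β * (2 : ℝ) ^ (1 - (β : ℝ) / 20) - ε ≤
      ((PMF.uniformOfFintype (Matrix (Fin k) (Fin n) F)).toOuterMeasure
        {B | ∃ B', CodeReduction.selectiveBackwardReduction sel β B = some B' ∧
          ∀ i : Fin k,
            ((i : ℕ) : ℝ) + 1 ≤
              2 * Real.logb q β - Real.logb q (20 * Real.logb 2 (2 / ε)) →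
            2 ≤ hammingNorm (CodeReduction.epipodal B' i)}).toReal := by
  have hq2 : 2 ≤ q := hq ▸ Fintype.one_lt_card
  have hkβ : k + β ≤ n := CodeReduction.add_le_of_le_div_logb hkn hdvd hβ hβn
  set X := 2 * Real.logb q β - Real.logb q (20 * Real.logb 2 (2 / ε)) with hX
  rw [CodeReduction.toReal_uniformOfFintype_apply]
  set G := {B : Matrix (Fin k) (Fin n) F |
    ∃ B', CodeReduction.selectiveBackwardReduction sel β B = some B' ∧
      ∀ i : Fin k, ((i : ℕ) : ℝ) + 1 ≤ X → 2 ≤ hammingNorm (CodeReduction.epipodal B' i)} with hG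
  let Z : Finset (Fin k) := Finset.univ.filter fun r => ((r : ℕ) : ℝ) + 1 ≤ X
  let bad : Fin k → Set (Matrix (Fin k) (Fin n) F) := fun r =>
    {B | CodeReduction.LeadingColsSpan (k + β) B ∧ ¬ 2 ≤ hammingNorm (CodeReduction.epipodal
      (CodeReduction.reduceLoop sel β ((n - k) / β - 1) (k + 2 * β)
        (CodeReduction.initialState B)) r)}
  let p : ℕ → ℝ := fun r =>
    2 ^ (-(β : ℝ) / 20) + 2 ^ (-((β : ℝ) ^ 2) / (20 * (q : ℝ) ^ (r + 1)))
  have hcover : Gᶜ ⊆ {B | ¬ CodeReduction.LeadingColsSpan (k + β) B} ∪ ⋃ r ∈ Z, bad r := by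
    intro B hB
    by_cases hspan : CodeReduction.LeadingColsSpan (k + β) B
    · right
      by_contra hnot
      refine hB ⟨_, CodeReduction.selectiveBackwardReduction_eq_some hspan, fun r hr => ?_⟩
      by_contra h2
      exact hnot (Set.mem_biUnion (Finset.mem_filter.2 ⟨Finset.mem_univ r, hr⟩) ⟨hspan, h2⟩)
    · exact Or.inl hspan
  have hbad : ∀ r ∈ Z, CodeReduction.density (bad r) ≤ p r := by
    intro r hr
    have hN := CodeReduction.succ_le_of_le_logb hq2 hkn hdvd hβ hβn hε0 hε1
      (Finset.mem_filter.1 hr).2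
    obtain ⟨s, hs⟩ : ∃ s, (r : ℕ) + 1 + s = (n - k) / β - 1 :=
      ⟨(n - k) / β - 1 - (r + 1), by omega⟩
    -- The fresh block fits into the matrix: `s + 2 ≤ (n - k) / β`, because `r + 1 ≥ 1`.
    have hn : k + β + s * β + β ≤ n := by
      have h1 : (s + 2) * β ≤ (n - k) / β * β := Nat.mul_le_mul_right _ (by omega)
      rw [Nat.div_mul_cancel hdvd, add_mul] at h1
      omega
    refine (CodeReduction.density_mono ?_).trans
      ((CodeReduction.density_injectiveOffZero_stateAfter_le (sel := sel) hβ r hn).trans_eq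
        (by rw [← hq]))
    rintro B ⟨hspan, h2⟩
    exact ⟨hspan, not_not.1 fun h =>
      h2 (CodeReduction.two_le_hammingNorm_of_not_injectiveOffZero hsel B r hs hn h)⟩
  -- Rows are counted from `0`, so `r + 1 ≤ X` places `r` in `range ⌊X⌋₊`; indices beyond the actual
  -- rows only add nonnegative terms.
  have hsum : ∑ r ∈ Z, CodeReduction.density (bad r) ≤ ∑ r ∈ Finset.range ⌊X⌋₊, p r := by
    refine (Finset.sum_le_sum hbad).trans ?_
    refine (Finset.sum_map Z Fin.valEmbedding p).symm.trans_le ?_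
    refine Finset.sum_le_sum_of_subset_of_nonneg (fun x hx => ?_) fun _ _ _ => by positivity
    obtain ⟨r, hr, rfl⟩ := Finset.mem_map.1 hx
    refine Finset.mem_range.2 (Nat.le_floor ?_)
    push_cast
    exact (Finset.mem_filter.1 hr).2
  have hfail := (CodeReduction.density_mono hcover).trans (CodeReduction.density_union_le _ _)
  have hspan := CodeReduction.density_not_leadingColsSpan_le (F := F) hkβ
  rw [← hq] at hspan
  have hunion := (CodeReduction.density_biUnion_le Z bad).trans hsum
  have htotal := CodeReduction.failure_sum_le hq2 hβ hε0 hε1 rfl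
  have hcompl := CodeReduction.density_add_density_compl G
  linarith
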